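/- Let $n\ge 2$ be an even integer, let $Q,u:\mathbb{R}^n\to\mathbb{R}$ be smooth, and let $|\mathbb{S}^n|$ denote the volume of the standard unit $n$-sphere. Suppose that $u$ is a normal solution of $$(-\Delta)^{n/2}u(x)=Q(x)e^{nu(x)}\quad\text{on }\mathbb{R}^n,$$ that is, $u$ satisfies this equation, $Qe^{nu}\in L^1(\mathbb{R}^n)$, and there is a constant $C_0$ such that for all $x\in\mathbb{R}^n$ $$u(x)=\frac{2}{(n-1)!\,|\mathbb{S}^n|}\int_{\mathbb{R}^n}\log\frac{|y|}{|x-y|}\,Q(y)e^{nu(y)}\,dy+C_0 .$$ Suppose further that $u$ is radially symmetric (that is, $u(x)$ depends only on $|x|$) and that there are constants $C\in\mathbb{R}$ and $k\ge 0$ with $$(n-1)!\le Q(x)\le C(|x|+1)^k\quad\text{for all }x\in\mathbb{R}^n .$$ Then $e^{nu}\in L^1(\mathbb{R}^n)$ and $$\int_{\mathbb{R}^n}e^{nu}\,dx\le|\mathbb{S}^n|,$$ with equality if and only if $Q(x)=(n-1)!$ for all $x\in\mathbb{R}^n$. -/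

import Mathlib

open MeasureTheory
open scoped ContDiff

noncomputable section

/-- The volume `|𝕊ⁿ|` of the standard unit `n`-sphere in `ℝⁿ⁺¹`, for the surface measure induced
by Lebesgue measure on `ℝⁿ⁺¹`. -/
def sphereVolume (n : ℕ) : ℝ :=
  (volume : Measure (EuclideanSpace ℝ (Fin (n + 1)))).toSphere.real Set.univ

/-- The operator `f ↦ -Δ f` on functions on `ℝⁿ`. -/
def negLaplacian (n : ℕ) (f : EuclideanSpace ℝ (Fin n) → ℝ) : EuclideanSpace ℝ (Fin n) → ℝ :=
  fun x => -Laplacian.laplacian f x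

/-- `u` is a normal solution of `(-Δ)^(n/2) u = Q e^(n u)` on `ℝⁿ` (`n` even): `u` and `Q` are
smooth, `u` solves the equation, `Q e^(n u)` is in `L¹(ℝⁿ)`, and `u` is, up to an additive
constant, the logarithmic potential of `Q e^(n u)`. -/
structure IsNormalSolution (n : ℕ) (Q u : EuclideanSpace ℝ (Fin n) → ℝ) : Prop where
  smooth_Q : ContDiff ℝ ∞ Q
  smooth_u : ContDiff ℝ ∞ u
  equation : ∀ x, ((negLaplacian n)^[n / 2] u) x = Q x * Real.exp (n * u x)
  integrable : Integrable (fun x => Q x * Real.exp (n * u x))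
  integral_equation : ∃ C : ℝ, ∀ x,
    u x = 2 / ((n - 1).factorial * sphereVolume n) *
        (∫ y, Real.log (‖y‖ / ‖x - y‖) * (Q y * Real.exp (n * u y))) + C

/-- `f` is radially symmetric: `f x` depends only on `‖x‖`. -/
def IsRadial {n : ℕ} (f : EuclideanSpace ℝ (Fin n) → ℝ) : Prop :=
  ∀ x y, ‖x‖ = ‖y‖ → f x = f y

end

/-! Identify ℝⁿ with ℂ^(n/2) and average log|x - y| over the circle of points e^(iθ)x. As u is
radial, its potential formula survives the averaging, and the averaged kernel is explicit
(`integral_log_norm_rot_sub`). Its derivative under dilation of x is k = `kernelDeriv`. Like the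
unaveraged ⟨x, x - y⟩/|x - y|², it satisfies k(x,y) + k(y,x) = 1; the gain is that k ≥ 0, with k > 0
for |y| < |x|.

Put V = ∫ e^(nu), N = (n-1)!, S = |𝕊ⁿ|. Invariance of V under dilations gives the Pohozaev identity
V = 2/(NS) ∬ k(x,y) e^(nu(x)) Q(y) e^(nu(y)) (`integral_exp_eq_integral_kernelDeriv`). Split Q = N +
(Q - N). By symmetrization the constant part contributes NV²/2, whence V(S - V) = (2/N) P with P = ∬
k(x,y) e^(nu(x)) (Q - N)(y) e^(nu(y)) ≥ 0. So V ≤ S, with equality iff P = 0, and positivity of k on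
|y| < |x| then forces Q = N. -/

/-! ### The logarithmic kernel averaged over circles. -/

noncomputable section CircleKernel

variable {E : Type*} [NormedAddCommGroup E] [InnerProductSpace ℝ E]

/-- A complex structure compatible with the inner product. -/
structure IsOrthogonalComplexStructure (J : E →L[ℝ] E) : Prop where
  skew : ∀ x y, inner ℝ (J x) y = -inner ℝ x (J y)
  sq : ∀ x, J (J x) = -x

/-- The squared modulus of the hermitian product attached to `J`. -/
def hermSq (J : E →L[ℝ] E) (x y : E) : ℝ := inner ℝ x y ^ 2 + inner ℝ (J x) y ^ 2

/-- The rotation by the angle `θ` in the complex lines of `J`. -/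
def rot (J : E →L[ℝ] E) (θ : ℝ) (x : E) : E := Real.cos θ • x + Real.sin θ • J x

/-- The discriminant `(‖x‖² + ‖y‖²)² - 4 |⟨x, y⟩|²`. -/
def kernelDisc (J : E →L[ℝ] E) (x y : E) : ℝ := (‖x‖ ^ 2 + ‖y‖ ^ 2) ^ 2 - 4 * hermSq J x y

/-- The mean of `log ‖x' - y‖` over the circle `{x'}` of rotations of `x`. -/
def circleKernel (J : E →L[ℝ] E) (x y : E) : ℝ :=
  1 / 2 * Real.log ((‖x‖ ^ 2 + ‖y‖ ^ 2 + √(kernelDisc J x y)) / 2)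

/-- The derivative of the circle kernel in the radial direction of the first variable. -/
def kernelDeriv (J : E →L[ℝ] E) (x y : E) : ℝ :=
  1 / 2 * (1 + (‖x‖ ^ 2 - ‖y‖ ^ 2) / √(kernelDisc J x y))

theorem kernelDeriv_pos (J : E →L[ℝ] E) {x y : E} (hxy : ‖y‖ < ‖x‖) : 0 < kernelDeriv J x y := by
  have : 0 ≤ (‖x‖ ^ 2 - ‖y‖ ^ 2) / √(kernelDisc J x y) := by
    apply div_nonneg _ (Real.sqrt_nonneg _)
    nlinarith [norm_nonneg y]
  rw [kernelDeriv]
  linarith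

namespace IsOrthogonalComplexStructure

variable {J : E →L[ℝ] E} (hJ : IsOrthogonalComplexStructure J)

include hJ

theorem inner_self_apply (x : E) : inner ℝ (J x) x = 0 := by
  have h := hJ.skew x x
  rw [real_inner_comm (J x) x] at h
  linarith

theorem norm_map (x : E) : ‖J x‖ = ‖x‖ := by
  have h := hJ.skew x (J x)
  rw [hJ.sq, inner_neg_right, neg_neg, real_inner_self_eq_norm_sq, real_inner_self_eq_norm_sq] at h
  exact (sq_eq_sq₀ (norm_nonneg _) (norm_nonneg _)).1 h

theorem hermSq_comm (x y : E) : hermSq J x y = hermSq J y x := by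
  unfold hermSq
  rw [hJ.skew x y, real_inner_comm x y, real_inner_comm x (J y)]
  ring

/-- Cauchy–Schwarz for the hermitian product, obtained by testing y against p • x + s • J x, a
multiple of its projection to the complex line of x. -/
theorem hermSq_le (x y : E) : hermSq J x y ≤ ‖x‖ ^ 2 * ‖y‖ ^ 2 := by
  set p := inner ℝ x y with hp
  set s := inner ℝ (J x) y with hs
  have h1 : inner ℝ (p • x + s • J x) y = hermSq J x y := by
    rw [inner_add_left, real_inner_smul_left, real_inner_smul_left, hermSq]
    ring
  have h2 : ‖p • x + s • J x‖ ^ 2 = hermSq J x y * ‖x‖ ^ 2 := by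
    rw [norm_add_sq_real, norm_smul, norm_smul, real_inner_smul_left, real_inner_smul_right,
      real_inner_comm, hJ.inner_self_apply, hJ.norm_map, mul_pow, mul_pow, Real.norm_eq_abs,
      Real.norm_eq_abs, sq_abs, sq_abs, hermSq]
    ring
  have h3 := abs_real_inner_le_norm (p • x + s • J x) y
  have h0 : 0 ≤ hermSq J x y := by unfold hermSq; positivity
  rw [h1, abs_of_nonneg h0] at h3
  have h4 : hermSq J x y ^ 2 ≤ hermSq J x y * (‖x‖ ^ 2 * ‖y‖ ^ 2) := by
    calc hermSq J x y ^ 2 ≤ (‖p • x + s • J x‖ * ‖y‖) ^ 2 := by gcongr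
      _ = _ := by rw [mul_pow, h2]; ring
  rcases h0.eq_or_lt with h | h
  · rw [← h]; positivity
  · rw [pow_two (hermSq J x y)] at h4
    exact le_of_mul_le_mul_left h4 h

theorem norm_rot (θ : ℝ) (x : E) : ‖rot J θ x‖ = ‖x‖ := by
  have : ‖rot J θ x‖ ^ 2 = ‖x‖ ^ 2 := by
    rw [rot, norm_add_sq_real, norm_smul, norm_smul, real_inner_smul_left, real_inner_smul_right,
      real_inner_comm, hJ.inner_self_apply, hJ.norm_map, mul_pow, mul_pow, Real.norm_eq_abs,
      Real.norm_eq_abs, sq_abs, sq_abs]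
    linear_combination ‖x‖ ^ 2 * Real.sin_sq_add_cos_sq θ
  exact (sq_eq_sq₀ (norm_nonneg _) (norm_nonneg _)).1 this

theorem norm_rot_sub_sq (θ : ℝ) (x y : E) :
    ‖rot J θ x - y‖ ^ 2 = ‖x‖ ^ 2 + ‖y‖ ^ 2
      - 2 * (Real.cos θ * inner ℝ x y + Real.sin θ * inner ℝ (J x) y) := by
  rw [norm_sub_sq_real, hJ.norm_rot, rot, inner_add_left, real_inner_smul_left,
    real_inner_smul_left]
  ring

theorem sq_le_kernelDisc (x y : E) : (‖x‖ ^ 2 - ‖y‖ ^ 2) ^ 2 ≤ kernelDisc J x y := by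
  have := hJ.hermSq_le x y
  unfold kernelDisc
  linarith

/-- As a function of θ, ‖rot J θ x - y‖ equals |A e^(iθ) - w| for a complex w with |w| ≤ A, and the
circle mean of log|A e^(iθ) - w| is then log A. -/
theorem integral_log_norm_rot_sub (x y : E) :
    ∫ θ in 0..2 * Real.pi, Real.log ‖rot J θ x - y‖ = 2 * Real.pi * circleKernel J x y := by
  set a := ‖x‖ ^ 2 + ‖y‖ ^ 2 with ha
  have hd : 0 ≤ kernelDisc J x y := (sq_nonneg _).trans (hJ.sq_le_kernelDisc x y)
  have ha0 : 0 ≤ a := by positivity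
  -- If x = y = 0, both sides vanish because `Real.log 0 = 0`.
  rcases ha0.eq_or_lt with h0 | h0
  · have hx : x = 0 := by
      have : ‖x‖ ^ 2 = 0 := le_antisymm (by nlinarith [sq_nonneg ‖y‖]) (sq_nonneg _)
      simpa using this
    have hy : y = 0 := by
      have : ‖y‖ ^ 2 = 0 := le_antisymm (by nlinarith [sq_nonneg ‖x‖]) (sq_nonneg _)
      simpa using this
    subst hx hy
    simp [rot, circleKernel, kernelDisc, hermSq]
  -- B is the larger root of B (a - B) = |⟨x, y⟩_ℂ|²; the smaller root a - B will be |w|².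
  set B := (a + √(kernelDisc J x y)) / 2 with hB
  have hBpos : 0 < B := by positivity
  have hBeq : hermSq J x y = B * (a - B) := by
    have := Real.sq_sqrt hd
    rw [hB]
    unfold kernelDisc at this ⊢
    rw [← ha] at this ⊢
    linear_combination (1 / 4) * this
  have hBle : a - B ≤ B := by
    rw [hB]; linarith [Real.sqrt_nonneg (kernelDisc J x y)]
  set A := √B with hA
  have hApos : 0 < A := Real.sqrt_pos.2 hBpos
  have hAsq : A ^ 2 = B := Real.sq_sqrt hBpos.le
  let w : ℂ := ⟨inner ℝ x y / A, inner ℝ (J x) y / A⟩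
  have hw : ‖w‖ ^ 2 = a - B := by
    rw [Complex.sq_norm, Complex.normSq_apply]
    simp only [w]
    have : inner ℝ x y / A * (inner ℝ x y / A) + inner ℝ (J x) y / A * (inner ℝ (J x) y / A)
        = hermSq J x y / A ^ 2 := by
      unfold hermSq; field_simp
    rw [this, hAsq, hBeq]
    field_simp
  have hwA : ‖w‖ ≤ A := by
    apply le_of_sq_le_sq _ hApos.le
    rw [hw, hAsq]; exact hBle
  have key := circleAverage_log_norm_sub_const_of_mem_closedBall (a := w) (c := 0) (R := A)
    (by simpa [abs_of_pos hApos] using hwA)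
  rw [Real.circleAverage_def, smul_eq_mul, inv_mul_eq_iff_eq_mul₀ (by positivity)] at key
  have hlog : Real.log A = circleKernel J x y := by
    rw [hA, Real.log_sqrt hBpos.le, circleKernel, ← ha, ← hB]; ring
  rw [← hlog, ← key]
  congr 1
  ext θ
  congr 1
  refine (sq_eq_sq₀ (norm_nonneg _) (norm_nonneg _)).1 ?_
  rw [hJ.norm_rot_sub_sq, Complex.sq_norm, Complex.normSq_apply]
  simp only [w, circleMap, zero_add, Complex.sub_re, Complex.sub_im, Complex.mul_re,
    Complex.mul_im, Complex.ofReal_re, Complex.ofReal_im, Complex.exp_ofReal_mul_I_re,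
    Complex.exp_ofReal_mul_I_im, zero_mul, sub_zero, add_zero]
  have e1 : (A * Real.cos θ - inner ℝ x y / A) * (A * Real.cos θ - inner ℝ x y / A) +
      (A * Real.sin θ - inner ℝ (J x) y / A) * (A * Real.sin θ - inner ℝ (J x) y / A)
      = A ^ 2 * (Real.sin θ ^ 2 + Real.cos θ ^ 2) + hermSq J x y / A ^ 2
        - 2 * (Real.cos θ * inner ℝ x y + Real.sin θ * inner ℝ (J x) y) := by
    unfold hermSq; field_simp; ring
  rw [e1, Real.sin_sq_add_cos_sq, hAsq, hBeq]
  field_simp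
  ring

theorem kernelDisc_comm (x y : E) : kernelDisc J x y = kernelDisc J y x := by
  rw [kernelDisc, kernelDisc, hJ.hermSq_comm, add_comm]

theorem kernelDeriv_add_swap (x y : E) : kernelDeriv J x y + kernelDeriv J y x = 1 := by
  rw [kernelDeriv, kernelDeriv, hJ.kernelDisc_comm y x]
  ring

theorem abs_sub_le_sqrt_kernelDisc (x y : E) : |‖x‖ ^ 2 - ‖y‖ ^ 2| ≤ √(kernelDisc J x y) :=
  Real.abs_le_sqrt (hJ.sq_le_kernelDisc x y)

/-- The quotient lies in [-1, 1], also when the discriminant vanishes, since division by zero gives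
0. -/
theorem kernelDeriv_nonneg (x y : E) : 0 ≤ kernelDeriv J x y := by
  have h := hJ.abs_sub_le_sqrt_kernelDisc x y
  have : |(‖x‖ ^ 2 - ‖y‖ ^ 2) / √(kernelDisc J x y)| ≤ 1 := by
    rw [abs_div, abs_of_nonneg (Real.sqrt_nonneg _)]
    exact div_le_one_of_le₀ h (Real.sqrt_nonneg _)
  rw [kernelDeriv]
  linarith [(abs_le.1 this).1]

end IsOrthogonalComplexStructure

end CircleKernel

/-! ### Behaviour of the circle kernel under dilations. -/

noncomputable section KernelScaling

variable {E : Type*} [NormedAddCommGroup E] [InnerProductSpace ℝ E]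

theorem hermSq_smul_left (J : E →L[ℝ] E) (r : ℝ) (x y : E) :
    hermSq J (r • x) y = r ^ 2 * hermSq J x y := by
  simp only [hermSq, map_smul, real_inner_smul_left]
  ring

theorem hermSq_smul_right (J : E →L[ℝ] E) (r : ℝ) (x y : E) :
    hermSq J x (r • y) = r ^ 2 * hermSq J x y := by
  simp only [hermSq, real_inner_smul_right]
  ring

theorem norm_smul_sq (r : ℝ) (x : E) : ‖r • x‖ ^ 2 = r ^ 2 * ‖x‖ ^ 2 := by
  rw [norm_smul, mul_pow, Real.norm_eq_abs, sq_abs]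

theorem kernelArg_pos (J : E →L[ℝ] E) (x : E) {y : E} (hy : y ≠ 0) :
    0 < (‖x‖ ^ 2 + ‖y‖ ^ 2 + √(kernelDisc J x y)) / 2 := by
  have : 0 < ‖y‖ := norm_pos_iff.2 hy
  positivity

theorem circleKernel_smul_smul (J : E →L[ℝ] E) {r : ℝ} (hr : 0 < r) (x : E) {y : E} (hy : y ≠ 0) :
    circleKernel J (r • x) (r • y) = Real.log r + circleKernel J x y := by
  have hD : kernelDisc J (r • x) (r • y) = (r ^ 2) ^ 2 * kernelDisc J x y := by
    simp only [kernelDisc, hermSq_smul_left, hermSq_smul_right, norm_smul_sq]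
    ring
  have h : (‖r • x‖ ^ 2 + ‖r • y‖ ^ 2 + √(kernelDisc J (r • x) (r • y))) / 2
      = r ^ 2 * ((‖x‖ ^ 2 + ‖y‖ ^ 2 + √(kernelDisc J x y)) / 2) := by
    rw [hD, Real.sqrt_mul (by positivity), Real.sqrt_sq (by positivity), norm_smul_sq,
      norm_smul_sq]
    ring
  rw [circleKernel, h, Real.log_mul (by positivity) (kernelArg_pos J x hy).ne', Real.log_pow,
    circleKernel]
  push_cast
  ring

/-- The derivative 1 + s/√(s² + d) is nonnegative. -/
theorem add_sqrt_mono {s t d : ℝ} (hst : s ≤ t) (hd : 0 ≤ d) :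
    s + √(s ^ 2 + d) ≤ t + √(t ^ 2 + d) := by
  have h0 : 0 ≤ √(t ^ 2 + d) := Real.sqrt_nonneg _
  have h1 : √(t ^ 2 + d) ^ 2 = t ^ 2 + d := Real.sq_sqrt (by positivity)
  have h2 : -t ≤ √(t ^ 2 + d) := (neg_le_abs t).trans (Real.abs_le_sqrt (by linarith))
  have h3 : √(s ^ 2 + d) ≤ √(t ^ 2 + d) + (t - s) := by
    apply Real.sqrt_le_iff.2 ⟨by linarith, ?_⟩
    nlinarith [mul_nonneg (sub_nonneg.2 hst) (by linarith : 0 ≤ √(t ^ 2 + d) + t)]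
  linarith

namespace IsOrthogonalComplexStructure

variable {J : E →L[ℝ] E} (hJ : IsOrthogonalComplexStructure J)

include hJ

theorem circleKernel_comm (x y : E) : circleKernel J x y = circleKernel J y x := by
  rw [circleKernel, circleKernel, hJ.kernelDisc_comm, add_comm (‖x‖ ^ 2)]

theorem circleKernel_smul_mono (x : E) {y : E} (hy : y ≠ 0) {r s : ℝ} (hr : 0 ≤ r) (hrs : r ≤ s) :
    circleKernel J (r • x) y ≤ circleKernel J (s • x) y := by
  rcases eq_or_ne x 0 with rfl | hx
  · simp
  have hX : 0 < ‖x‖ ^ 2 := by have := norm_pos_iff.2 hx; positivity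
  set b := hermSq J x y / ‖x‖ ^ 2 with hb
  have hb0 : 0 ≤ b := by unfold b hermSq; positivity
  have hb1 : b ≤ ‖y‖ ^ 2 := by
    rw [hb, div_le_iff₀ hX, mul_comm]; exact hJ.hermSq_le x y
  have hbeq : hermSq J x y = b * ‖x‖ ^ 2 := by rw [hb]; field_simp
  -- Completing the square in t²‖x‖² brings the kernel to the form of `add_sqrt_mono`; the remainder
  -- is nonnegative because 0 ≤ b ≤ ‖y‖².
  have hD : ∀ t : ℝ, kernelDisc J (t • x) y =
      (t ^ 2 * ‖x‖ ^ 2 + (‖y‖ ^ 2 - 2 * b)) ^ 2 + 4 * b * (‖y‖ ^ 2 - b) := by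
    intro t
    rw [kernelDisc, hermSq_smul_left, norm_smul_sq, hbeq]
    ring
  have hle : r ^ 2 * ‖x‖ ^ 2 ≤ s ^ 2 * ‖x‖ ^ 2 := by gcongr
  have key := add_sqrt_mono (s := r ^ 2 * ‖x‖ ^ 2 + (‖y‖ ^ 2 - 2 * b))
    (t := s ^ 2 * ‖x‖ ^ 2 + (‖y‖ ^ 2 - 2 * b)) (d := 4 * b * (‖y‖ ^ 2 - b)) (by linarith)
    (mul_nonneg (by positivity) (by linarith))
  rw [← hD, ← hD] at key
  have := Real.log_le_log (kernelArg_pos J (r • x) hy)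
    (y := (‖s • x‖ ^ 2 + ‖y‖ ^ 2 + √(kernelDisc J (s • x) y)) / 2)
    (by rw [norm_smul_sq, norm_smul_sq]; linarith)
  rw [circleKernel, circleKernel]
  linarith

/-- Homogeneity and symmetry move the dilation to the other variable, with t reversed. -/
theorem circleKernel_exp_smul {x y : E} (hy : y ≠ 0) (t : ℝ) :
    circleKernel J (Real.exp t • x) y = t + circleKernel J (Real.exp (-t) • y) x := by
  have h : circleKernel J (Real.exp t • x) (Real.exp t • Real.exp (-t) • y) =
      Real.log (Real.exp t) + circleKernel J x (Real.exp (-t) • y) :=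
    circleKernel_smul_smul J (Real.exp_pos t) x (smul_ne_zero (Real.exp_pos _).ne' hy)
  rwa [smul_smul, ← Real.exp_add, add_neg_cancel, Real.exp_zero, one_smul, Real.log_exp,
    hJ.circleKernel_comm x] at h

/-- Along t the kernel is nondecreasing, while the kernel minus t is nonincreasing by
`circleKernel_exp_smul`; its slopes thus lie in [0, 1]. -/
theorem abs_circleKernel_exp_sub_le {x y : E} (hx : x ≠ 0) (hy : y ≠ 0) (s t : ℝ) :
    |circleKernel J (Real.exp s • x) y - circleKernel J (Real.exp t • x) y| ≤ |s - t| := by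
  wlog hst : s ≤ t generalizing s t
  · rw [abs_sub_comm, abs_sub_comm s]
    exact this t s (not_le.1 hst).le
  have h1 := hJ.circleKernel_smul_mono x hy (Real.exp_pos s).le (Real.exp_le_exp.2 hst)
  have h2 := hJ.circleKernel_smul_mono y hx (Real.exp_pos (-t)).le
    (Real.exp_le_exp.2 (neg_le_neg hst))
  have h3 := hJ.circleKernel_exp_smul (x := x) hy s
  have h4 := hJ.circleKernel_exp_smul (x := x) hy t
  rw [abs_of_nonpos (by linarith), abs_of_nonpos (by linarith)]
  linarith

theorem hasDerivAt_circleKernel_exp_smul {x y : E} (hxy : ‖x‖ ≠ ‖y‖) :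
    HasDerivAt (fun t : ℝ => circleKernel J (Real.exp t • x) y) (kernelDeriv J x y) 0 := by
  set X := ‖x‖ ^ 2 with hX
  set Y := ‖y‖ ^ 2 with hY
  set b := hermSq J x y with hb
  have hXY : 0 < (X - Y) ^ 2 := by
    apply sq_pos_of_ne_zero
    intro h
    exact hxy ((sq_eq_sq₀ (norm_nonneg _) (norm_nonneg _)).1 (sub_eq_zero.1 h))
  have hdisc : kernelDisc J x y = (X + Y) ^ 2 - 4 * b := rfl
  have hDpos : 0 < (X + Y) ^ 2 - 4 * b := hdisc ▸ hXY.trans_le (hJ.sq_le_kernelDisc x y)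
  have hsum : 0 < X + Y + √((X + Y) ^ 2 - 4 * b) := by
    have := Real.sqrt_pos.2 hDpos
    positivity
  have hE : HasDerivAt (fun t : ℝ => Real.exp t ^ 2) 2 0 := by
    simpa using (Real.hasDerivAt_exp 0).fun_pow 2
  have hA : HasDerivAt (fun t : ℝ => Real.exp t ^ 2 * X + Y) (2 * X) 0 :=
    (hE.mul_const X).add_const Y
  have hD : HasDerivAt (fun t : ℝ => (Real.exp t ^ 2 * X + Y) ^ 2 - 4 * (Real.exp t ^ 2 * b))
      (2 * (X + Y) * (2 * X) - 4 * (2 * b)) 0 := by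
    simpa using (hA.fun_pow 2).fun_sub ((hE.mul_const b).const_mul 4)
  have hS := hD.sqrt (by simpa using hDpos.ne')
  have hF := (((hA.add hS).div_const 2).log (by simpa using hsum.ne')).const_mul (1 / 2)
  simp only [Pi.add_apply, Real.exp_zero, one_pow, one_mul] at hF
  have hval : kernelDeriv J x y = 1 / 2 * (((2 * X + (2 * (X + Y) * (2 * X) - 4 * (2 * b)) /
      (2 * √((X + Y) ^ 2 - 4 * b))) / 2) / ((X + Y + √((X + Y) ^ 2 - 4 * b)) / 2)) := by
    rw [kernelDeriv, hdisc, ← hX, ← hY]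
    have hsq := Real.sq_sqrt hDpos.le
    have hs := Real.sqrt_pos.2 hDpos
    generalize √((X + Y) ^ 2 - 4 * b) = S at *
    field_simp
    linear_combination hsq
  rw [hval]
  convert! hF using 1
  ext t
  rw [circleKernel, kernelDisc, hermSq_smul_left, norm_smul_sq]

end IsOrthogonalComplexStructure

end KernelScaling

/-! ### The identification of ℝⁿ with ℂ^(n/2) for even n. -/

noncomputable section ComplexStructure

/-- The involution of `Fin n` (`n` even) exchanging `2 k` and `2 k + 1`. -/
def pairSwap {n : ℕ} (hn : Even n) : Equiv.Perm (Fin n) :=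
  Function.Involutive.toPerm
    (fun i : Fin n => if h : i.1 % 2 = 0 then ⟨i.1 + 1, by obtain ⟨m, rfl⟩ := hn; omega⟩
      else ⟨i.1 - 1, by omega⟩)
    (by
      intro i
      ext
      by_cases h : i.1 % 2 = 0
      · have h' : ¬ (i.1 + 1) % 2 = 0 := by omega
        simp [h, h']
      · have h' : (i.1 - 1) % 2 = 0 := by omega
        simp only [h, h', dite_true, dite_false]
        omega)

/-- The sign attached to an index by its parity. -/
def pairSign {n : ℕ} (i : Fin n) : ℝ := if i.1 % 2 = 0 then -1 else 1

theorem pairSwap_pairSwap {n : ℕ} (hn : Even n) (i : Fin n) :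
    pairSwap hn (pairSwap hn i) = i :=
  Function.Involutive.toPerm_involutive _ i

/-- This sign change yields both skewness and J² = -1. -/
theorem pairSign_pairSwap {n : ℕ} (hn : Even n) (i : Fin n) :
    pairSign (pairSwap hn i) = -pairSign i := by
  have hv : (pairSwap hn i).1 = if i.1 % 2 = 0 then i.1 + 1 else i.1 - 1 := by
    by_cases h : i.1 % 2 = 0 <;> simp [pairSwap, Function.Involutive.toPerm, h]
  unfold pairSign
  rw [hv]
  split_ifs <;> first | omega | norm_num

theorem pairSign_mul_self {n : ℕ} (i : Fin n) : pairSign i * pairSign i = 1 := by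
  unfold pairSign
  split_ifs <;> norm_num

/-- The standard complex structure on `ℝⁿ`, `n` even. -/
def stdComplexStructure {n : ℕ} (hn : Even n) :
    EuclideanSpace ℝ (Fin n) →L[ℝ] EuclideanSpace ℝ (Fin n) :=
  LinearMap.toContinuousLinearMap
    { toFun := fun x => WithLp.toLp 2 fun i => pairSign i * x (pairSwap hn i)
      map_add' := by intro x y; ext i; simp [mul_add]
      map_smul' := by intro c x; ext i; simp; ring }

theorem stdComplexStructure_apply {n : ℕ} (hn : Even n) (x : EuclideanSpace ℝ (Fin n))
    (i : Fin n) : stdComplexStructure hn x i = pairSign i * x (pairSwap hn i) := rfl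

theorem isOrthogonalComplexStructure_std {n : ℕ} (hn : Even n) :
    IsOrthogonalComplexStructure (stdComplexStructure hn) where
  skew x y := by
    simp only [PiLp.inner_apply, stdComplexStructure_apply, RCLike.inner_apply, conj_trivial]
    rw [← Equiv.sum_comp (pairSwap hn), ← Finset.sum_neg_distrib]
    refine Finset.sum_congr rfl fun i _ => ?_
    rw [pairSwap_pairSwap, pairSign_pairSwap]
    ring
  sq x := by
    ext i
    rw [stdComplexStructure_apply, stdComplexStructure_apply, pairSwap_pairSwap,
      pairSign_pairSwap, PiLp.neg_apply]
    linear_combination (-x i) * pairSign_mul_self i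

end ComplexStructure

/-! ### Integrability of the logarithmic potential and its circle average. -/

noncomputable section LogPotential

theorem abs_log_norm_sub_log_norm_le {E : Type*} [NormedAddCommGroup E] {R : ℝ} {z y : E} (hR : 0 < R) (hz : ‖z‖ ≤ R)
    (hy : 2 * R ≤ ‖y‖) : |Real.log ‖y‖ - Real.log ‖z - y‖| ≤ Real.log 2 := by
  have hy0 : 0 < ‖y‖ := by linarith
  have h1 : ‖y‖ / 2 ≤ ‖z - y‖ := by
    have := norm_sub_norm_le y z
    rw [norm_sub_rev] at this
    linarith
  have h2 : ‖z - y‖ ≤ 2 * ‖y‖ := by linarith [norm_sub_le z y]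
  have h3 : 0 < ‖z - y‖ := by linarith
  have l1 := Real.log_le_log (by positivity) h1
  have l2 := Real.log_le_log h3 h2
  rw [Real.log_div hy0.ne' two_ne_zero] at l1
  rw [Real.log_mul two_ne_zero hy0.ne'] at l2
  rw [abs_le]
  constructor <;> linarith

variable {E : Type*} [NormedAddCommGroup E] [InnerProductSpace ℝ E] [FiniteDimensional ℝ E]
  [MeasurableSpace E] [BorelSpace E]

/-- The exponent -1/2 is locally integrable in every dimension ≥ 1. -/
theorem abs_log_le_rpow {r R : ℝ} (hr : 0 < r) (hR : r ≤ R) :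
    |Real.log r| ≤ (2 + R ^ (3 / 2 : ℝ)) * r ^ (-(1 / 2 : ℝ)) := by
  have hp : 0 < r ^ (-(1 / 2 : ℝ)) := Real.rpow_pos_of_pos hr _
  have hR0 : 0 ≤ R ^ (3 / 2 : ℝ) := Real.rpow_nonneg (hr.le.trans hR) _
  rcases le_total r 1 with h | h
  · have h1 := Real.abs_log_mul_self_rpow_lt r (1 / 2) hr h (by norm_num)
    rw [abs_mul, abs_of_pos (Real.rpow_pos_of_pos hr _)] at h1
    have h2 : r ^ (1 / 2 : ℝ) * r ^ (-(1 / 2 : ℝ)) = 1 := by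
      rw [← Real.rpow_add hr]; norm_num
    have h3 : |Real.log r| = |Real.log r| * r ^ (1 / 2 : ℝ) * r ^ (-(1 / 2 : ℝ)) := by
      rw [mul_assoc, h2, mul_one]
    rw [h3]
    gcongr
    norm_num at h1 ⊢
    linarith
  · rw [abs_of_nonneg (Real.log_nonneg h)]
    calc Real.log r ≤ r := Real.log_le_self hr.le
      _ = r ^ (3 / 2 : ℝ) * r ^ (-(1 / 2 : ℝ)) := by
        rw [← Real.rpow_add hr]; norm_num
      _ ≤ _ := by
        gcongr
        have : r ^ (3 / 2 : ℝ) ≤ R ^ (3 / 2 : ℝ) := by gcongr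
        linarith

theorem integrableOn_log_norm_ball [Nontrivial E] (R : ℝ) :
    IntegrableOn (fun x : E => Real.log ‖x‖) (Metric.ball 0 R) volume := by
  have hd : 1 ≤ Module.finrank ℝ E := Module.finrank_pos
  refine integrableOn_ball_of_norm_le_rpow hd (α := 1 / 2) (C := 2 + R ^ (3 / 2 : ℝ)) ?_ ?_ ?_
  · have : (1 : ℝ) ≤ Module.finrank ℝ E := by exact_mod_cast hd
    linarith
  · refine (ae_restrict_iff' measurableSet_ball).2 ?_
    have h0 : ∀ᵐ x : E ∂volume, x ≠ 0 := by
      simp [ae_iff, measure_singleton]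
    filter_upwards [h0] with x hx hxR
    exact abs_log_le_rpow (norm_pos_iff.2 hx) (mem_ball_zero_iff.1 hxR).le
  · exact (Real.measurable_log.comp measurable_norm).aestronglyMeasurable

theorem lintegral_log_norm_sub_ball_le {R : ℝ} {z : E} (hz : ‖z‖ ≤ R) :
    ∫⁻ y in Metric.ball (0 : E) (2 * R), ‖Real.log ‖z - y‖‖ₑ ≤
      ∫⁻ y in Metric.ball (0 : E) (3 * R), ‖Real.log ‖y‖‖ₑ := by
  rw [← lintegral_indicator measurableSet_ball, ← lintegral_indicator measurableSet_ball,
    ← lintegral_sub_left_eq_self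
      ((Metric.ball (0 : E) (3 * R)).indicator fun y => ‖Real.log ‖y‖‖ₑ) z]
  refine lintegral_mono fun y => ?_
  by_cases hy : y ∈ Metric.ball (0 : E) (2 * R)
  · have : z - y ∈ Metric.ball (0 : E) (3 * R) := by
      rw [mem_ball_zero_iff] at hy ⊢
      linarith [norm_sub_le z y]
    rw [Set.indicator_of_mem hy, Set.indicator_of_mem this]
  · rw [Set.indicator_of_notMem hy]
    exact zero_le

/-- The `L¹` norm of the integrand of the logarithmic potential is locally bounded. -/
theorem exists_lintegral_log_potential_le [Nontrivial E] {q : E → ℝ} (hq : Continuous q)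
    (hqi : Integrable q) {R : ℝ} (hR : 0 < R) :
    ∃ C : ENNReal, C ≠ ⊤ ∧ ∀ z : E, ‖z‖ ≤ R →
      ∫⁻ y, ‖(Real.log ‖y‖ - Real.log ‖z - y‖) * q y‖ₑ ≤ C := by
  -- Inside radius 2R, q is bounded by B and the logarithms are integrable; outside, the difference
  -- of logarithms is at most log 2 and q is integrable.
  obtain ⟨B, hB⟩ := (isCompact_closedBall (0 : E) (2 * R)).exists_bound_of_continuousOn
    hq.continuousOn
  set I := ∫⁻ y in Metric.ball (0 : E) (3 * R), ‖Real.log ‖y‖‖ₑ with hI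
  have hIfin : I ≠ ⊤ := (integrableOn_log_norm_ball (E := E) (3 * R)).2.ne
  refine ⟨(I + I) * ENNReal.ofReal B + ENNReal.ofReal (Real.log 2) * ∫⁻ y, ‖q y‖ₑ, ?_, ?_⟩
  · exact ENNReal.add_ne_top.2 ⟨ENNReal.mul_ne_top (ENNReal.add_ne_top.2 ⟨hIfin, hIfin⟩)
      ENNReal.ofReal_ne_top, ENNReal.mul_ne_top ENNReal.ofReal_ne_top hqi.2.ne⟩
  intro z hz
  have hm0 : Measurable fun y : E => ‖Real.log ‖y‖‖ₑ :=
    (Real.measurable_log.comp measurable_norm).enorm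
  rw [← lintegral_add_compl _ (measurableSet_ball (x := (0 : E)) (ε := 2 * R))]
  gcongr ?_ + ?_
  · calc ∫⁻ y in Metric.ball (0 : E) (2 * R), ‖(Real.log ‖y‖ - Real.log ‖z - y‖) * q y‖ₑ
        ≤ ∫⁻ y in Metric.ball (0 : E) (2 * R),
            (‖Real.log ‖y‖‖ₑ + ‖Real.log ‖z - y‖‖ₑ) * ENNReal.ofReal B := by
          refine setLIntegral_mono' measurableSet_ball fun y hy => ?_
          rw [enorm_mul]
          gcongr
          · exact enorm_sub_le
          · rw [← ofReal_norm]
            exact ENNReal.ofReal_le_ofReal (hB y (Metric.ball_subset_closedBall hy))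
      _ ≤ (I + I) * ENNReal.ofReal B := by
          rw [lintegral_mul_const' _ _ ENNReal.ofReal_ne_top, lintegral_add_left hm0]
          gcongr
          · exact lintegral_mono_set (Metric.ball_subset_ball (by linarith))
          · exact lintegral_log_norm_sub_ball_le hz
  · calc ∫⁻ y in (Metric.ball (0 : E) (2 * R))ᶜ, ‖(Real.log ‖y‖ - Real.log ‖z - y‖) * q y‖ₑ
        ≤ ∫⁻ y in (Metric.ball (0 : E) (2 * R))ᶜ, ENNReal.ofReal (Real.log 2) * ‖q y‖ₑ := by
          refine setLIntegral_mono' measurableSet_ball.compl fun y hy => ?_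
          rw [enorm_mul]
          gcongr
          rw [← ofReal_norm]
          refine ENNReal.ofReal_le_ofReal (abs_log_norm_sub_log_norm_le hR hz ?_)
          simpa using hy
      _ ≤ ENNReal.ofReal (Real.log 2) * ∫⁻ y, ‖q y‖ₑ := by
          rw [lintegral_const_mul' _ _ ENNReal.ofReal_ne_top]
          gcongr
          exact Measure.restrict_le_self

theorem measurable_log_potential {q : E → ℝ} (hq : Continuous q) :
    Measurable fun p : E × E => (Real.log ‖p.2‖ - Real.log ‖p.1 - p.2‖) * q p.2 := by
  have := hq.measurable
  fun_prop

/-- The logarithmic potential averaged over the circle of rotations of `x`. -/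
theorem integral_log_potential_rot [Nontrivial E] {J : E →L[ℝ] E}
    (hJ : IsOrthogonalComplexStructure J) {q : E → ℝ} (hq : Continuous q)
    (hqi : Integrable q) (x : E) :
    Integrable (fun y => (Real.log ‖y‖ - circleKernel J x y) * q y) ∧
    ∫ θ in 0..2 * Real.pi, ∫ y, (Real.log ‖y‖ - Real.log ‖rot J θ x - y‖) * q y =
      2 * Real.pi * ∫ y, (Real.log ‖y‖ - circleKernel J x y) * q y := by
  obtain ⟨C, hC, h⟩ := exists_lintegral_log_potential_le hq hqi (R := ‖x‖ + 1) (by positivity)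
  have hrot : Continuous fun θ => rot J θ x := by unfold rot; fun_prop
  have hm : Measurable fun p : ℝ × E =>
      (Real.log ‖p.2‖ - Real.log ‖rot J p.1 x - p.2‖) * q p.2 :=
    (measurable_log_potential hq).comp
      ((hrot.measurable.comp measurable_fst).prodMk measurable_snd)
  have hint : Integrable (fun p : ℝ × E =>
      (Real.log ‖p.2‖ - Real.log ‖rot J p.1 x - p.2‖) * q p.2)
      ((volume.restrict (Set.Ioc 0 (2 * Real.pi))).prod volume) := by
    refine ⟨hm.aestronglyMeasurable, ?_⟩
    rw [hasFiniteIntegral_iff_enorm, lintegral_prod _ hm.enorm.aemeasurable]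
    have hb : ∀ θ : ℝ, ∫⁻ y, ‖(Real.log ‖y‖ - Real.log ‖rot J θ x - y‖) * q y‖ₑ ≤ C :=
      fun θ => h _ (by rw [hJ.norm_rot]; linarith)
    refine (lintegral_mono hb).trans_lt ?_
    rw [setLIntegral_const]
    exact ENNReal.mul_lt_top hC.lt_top measure_Ioc_lt_top
  have hinner : ∀ᵐ y ∂(volume : Measure E),
      ∫ θ in Set.Ioc 0 (2 * Real.pi), (Real.log ‖y‖ - Real.log ‖rot J θ x - y‖) * q y =
        2 * Real.pi * ((Real.log ‖y‖ - circleKernel J x y) * q y) := by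
    have hpos : 0 < 2 * Real.pi := by positivity
    filter_upwards [hint.prod_left_ae] with y hy
    -- Where q y ≠ 0, dividing by it extracts integrability in θ of the logarithm from Fubini.
    rcases eq_or_ne (q y) 0 with h0 | h0
    · simp [h0]
    have h1 : Integrable (fun θ => Real.log ‖y‖ - Real.log ‖rot J θ x - y‖)
        (volume.restrict (Set.Ioc 0 (2 * Real.pi))) := by
      simpa [mul_assoc, h0] using hy.mul_const (q y)⁻¹
    have h2 : Integrable (fun θ => Real.log ‖rot J θ x - y‖)
        (volume.restrict (Set.Ioc 0 (2 * Real.pi))) := by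
      exact ((integrable_const (Real.log ‖y‖)).sub h1).congr
        (Filter.Eventually.of_forall fun θ => by simp)
    rw [integral_mul_const, integral_sub (integrable_const _) h2,
      ← intervalIntegral.integral_of_le (f := fun θ => Real.log ‖rot J θ x - y‖) hpos.le, hJ.integral_log_norm_rot_sub]
    simp [Real.pi_pos.le]
    ring
  have hpi : 2 * Real.pi ≠ 0 := by positivity
  constructor
  · have := (hint.integral_prod_right.congr hinner).const_mul (2 * Real.pi)⁻¹
    refine this.congr (Filter.Eventually.of_forall fun y => ?_)
    simp only
    rw [inv_mul_cancel_left₀ hpi]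
  · rw [intervalIntegral.integral_of_le (by positivity), integral_integral_swap hint,
      integral_congr_ae hinner, integral_const_mul]

end LogPotential

/-! ### The Pohozaev identity by first variation under dilations. -/

noncomputable section Pohozaev

variable {E : Type*} [NormedAddCommGroup E] [InnerProductSpace ℝ E] [FiniteDimensional ℝ E]
  [MeasurableSpace E] [BorelSpace E]

theorem measurable_kernelDisc (J : E →L[ℝ] E) :
    Measurable fun z : E × E => kernelDisc J z.1 z.2 := by
  unfold kernelDisc hermSq
  exact Continuous.measurable (by fun_prop)

theorem measurable_circleKernel (J : E →L[ℝ] E) :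
    Measurable fun z : E × E => circleKernel J z.1 z.2 := by
  have := measurable_kernelDisc J
  unfold circleKernel
  fun_prop

theorem measurable_kernelDeriv (J : E →L[ℝ] E) :
    Measurable fun z : E × E => kernelDeriv J z.1 z.2 := by
  have := measurable_kernelDisc J
  unfold kernelDeriv
  fun_prop

/-- The increment of the circle kernel under the dilation of the first variable by `exp t`. -/
def kernelIncr (J : E →L[ℝ] E) (t : ℝ) (z : E × E) : ℝ :=
  circleKernel J (Real.exp t • z.1) z.2 - circleKernel J z.1 z.2

theorem measurable_kernelIncr (J : E →L[ℝ] E) (t : ℝ) : Measurable (kernelIncr J t) := by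
  have h1 := measurable_circleKernel J
  have h2 : Measurable fun z : E × E => (Real.exp t • z.1, z.2) := by fun_prop
  exact (h1.comp h2).sub h1

theorem ae_prod_norm_ne [Nontrivial E] :
    ∀ᵐ z : E × E ∂(volume.prod volume), z.1 ≠ 0 ∧ z.2 ≠ 0 ∧ ‖z.1‖ ≠ ‖z.2‖ := by
  have hm : MeasurableSet {z : E × E | z.1 ≠ 0 ∧ z.2 ≠ 0 ∧ ‖z.1‖ ≠ ‖z.2‖} := by
    refine ((isOpen_ne_fun continuous_fst continuous_const).inter
      ((isOpen_ne_fun continuous_snd continuous_const).inter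
      (isOpen_ne_fun (by fun_prop) (by fun_prop)))).measurableSet
  rw [Measure.ae_prod_iff_ae_ae hm]
  have h0 : ∀ᵐ x : E ∂volume, x ≠ 0 := by
    simp [ae_iff, measure_singleton]
  filter_upwards [h0] with x hx
  have h1 : ∀ᵐ y : E ∂volume, y ∉ Metric.sphere (0 : E) ‖x‖ :=
    measure_eq_zero_iff_ae_notMem.1 (Measure.addHaar_sphere volume 0 ‖x‖)
  filter_upwards [h0, h1] with y hy hy'
  refine ⟨hx, hy, fun h => hy' ?_⟩
  rw [mem_sphere_zero_iff_norm, h]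

section Potential

variable [Nontrivial E] {J : E →L[ℝ] E} (hJ : IsOrthogonalComplexStructure J)
  {u q : E → ℝ} {c C₀ : ℝ} (hq : Continuous q) (hqi : Integrable q)
  (hu : ∀ x, u x = c * (∫ y, (Real.log ‖y‖ - Real.log ‖x - y‖) * q y) + C₀)
  (hrad : ∀ x y, ‖x‖ = ‖y‖ → u x = u y)

include hJ hq hqi hu hrad

/-- u is constant on the circle through x, so averaging its potential formula over θ changes only
the kernel. -/
theorem eq_circleKernel_potential (x : E) :
    u x = c * (∫ y, (Real.log ‖y‖ - circleKernel J x y) * q y) + C₀ := by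
  have h := (integral_log_potential_rot hJ hq hqi x).2
  have hpi : 2 * Real.pi ≠ 0 := by positivity
  have h1 : ∀ θ : ℝ, u x = c * (∫ y, (Real.log ‖y‖ - Real.log ‖rot J θ x - y‖) * q y) + C₀ :=
    fun θ => by rw [← hu]; exact hrad _ _ (hJ.norm_rot θ x).symm
  rcases eq_or_ne c 0 with rfl | hc
  · simpa using h1 0
  have h2 : ∀ θ : ℝ, ∫ y, (Real.log ‖y‖ - Real.log ‖rot J θ x - y‖) * q y = (u x - C₀) / c := by
    intro θ
    rw [eq_div_iff hc, h1 θ]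
    ring
  simp only [h2, intervalIntegral.integral_const, sub_zero, smul_eq_mul] at h
  rw [← mul_left_cancel₀ hpi h]
  field_simp
  ring

theorem potential_exp_smul_sub (t : ℝ) (x : E) :
    u (Real.exp t • x) - u x = -(c * ∫ y, kernelIncr J t (x, y) * q y) := by
  rw [eq_circleKernel_potential hJ hq hqi hu hrad, eq_circleKernel_potential hJ hq hqi hu hrad x]
  have h := integral_sub (integral_log_potential_rot hJ hq hqi x).1
    (integral_log_potential_rot hJ hq hqi (Real.exp t • x)).1
  have h' : ∫ y, kernelIncr J t (x, y) * q y = ∫ y, ((Real.log ‖y‖ - circleKernel J x y) * q y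
      - (Real.log ‖y‖ - circleKernel J (Real.exp t • x) y) * q y) := by
    congr 1; ext y; simp only [kernelIncr]; ring
  rw [h', h]
  ring

end Potential

section Product

variable [Nontrivial E] {J : E →L[ℝ] E} (hJ : IsOrthogonalComplexStructure J)

include hJ

theorem integrable_kernelIncr_mul {w : E × E → ℝ} (hw : Integrable w (volume.prod volume))
    (t : ℝ) : Integrable (fun z => kernelIncr J t z * w z) (volume.prod volume) := by
  refine hw.bdd_mul (c := |t|) (measurable_kernelIncr J t).aestronglyMeasurable ?_
  filter_upwards [ae_prod_norm_ne] with z hz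
  have := hJ.abs_circleKernel_exp_sub_le hz.1 hz.2.1 t 0
  simpa [kernelIncr] using this

/-- The kernel is 1-Lipschitz in t, so |w| dominates the difference quotients. -/
theorem hasDerivAt_integral_kernelIncr_mul {w : E × E → ℝ}
    (hw : Integrable w (volume.prod volume)) :
    Integrable (fun z => kernelDeriv J z.1 z.2 * w z) (volume.prod volume) ∧
    HasDerivAt (fun t => ∫ z, kernelIncr J t z * w z ∂(volume.prod volume))
      (∫ z, kernelDeriv J z.1 z.2 * w z ∂(volume.prod volume)) 0 := by
  refine hasDerivAt_integral_of_dominated_loc_of_lip (s := Set.univ) Filter.univ_mem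
    (Filter.Eventually.of_forall fun t => (integrable_kernelIncr_mul hJ hw t).aestronglyMeasurable)
    (integrable_kernelIncr_mul hJ hw 0)
    ((measurable_kernelDeriv J).aestronglyMeasurable.mul hw.aestronglyMeasurable)
    (bound := fun z => |w z|) ?_ hw.abs ?_
  · filter_upwards [ae_prod_norm_ne] with z hz
    refine LipschitzOnWith.of_dist_le_mul fun s _ t _ => ?_
    rw [Real.dist_eq, Real.dist_eq, ← sub_mul, abs_mul, Real.coe_nnabs, abs_abs, mul_comm]
    refine mul_le_mul_of_nonneg_left ?_ (abs_nonneg _)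
    have := hJ.abs_circleKernel_exp_sub_le hz.1 hz.2.1 s t
    simpa [kernelIncr] using this
  · filter_upwards [ae_prod_norm_ne] with z hz
    exact ((hJ.hasDerivAt_circleKernel_exp_smul hz.2.2).sub_const _).mul_const _

/-- The symmetric part of the kernel is `1 / 2`. -/
theorem integral_kernelDeriv_mul_self {e : E → ℝ} (he : Integrable e) :
    ∫ z, kernelDeriv J z.1 z.2 * (e z.1 * e z.2) ∂(volume.prod volume) = (∫ x, e x) ^ 2 / 2 := by
  have hK := (hasDerivAt_integral_kernelIncr_mul hJ (he.mul_prod he)).1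
  have h1 := integral_prod_swap (μ := (volume : Measure E)) (ν := (volume : Measure E))
    (fun z : E × E => kernelDeriv J z.1 z.2 * (e z.1 * e z.2))
  have h2 := integral_add hK hK.swap
  have h3 : ∫ z : E × E, (kernelDeriv J z.1 z.2 * (e z.1 * e z.2) +
      ((fun z : E × E => kernelDeriv J z.1 z.2 * (e z.1 * e z.2)) ∘ Prod.swap) z)
        ∂(volume.prod volume) = ∫ z : E × E, e z.1 * e z.2 ∂(volume.prod volume) := by
    congr 1
    ext z
    have := hJ.kernelDeriv_add_swap z.1 z.2
    simp only [Function.comp_apply, Prod.fst_swap, Prod.snd_swap]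
    linear_combination (e z.1 * e z.2) * this
  rw [h3, integral_prod_mul] at h2
  simp only [Function.comp_apply] at h2
  rw [h1] at h2
  linarith

end Product

section Identity

variable [Nontrivial E] {J : E →L[ℝ] E} (hJ : IsOrthogonalComplexStructure J)
  {u q : E → ℝ} {c C₀ : ℝ} (hq : Continuous q) (hqi : Integrable q)
  (hu : ∀ x, u x = c * (∫ y, (Real.log ‖y‖ - Real.log ‖x - y‖) * q y) + C₀)
  (hrad : ∀ x y, ‖x‖ = ‖y‖ → u x = u y)
  (he : Integrable fun x => Real.exp (Module.finrank ℝ E * u x))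

include hJ hq hqi hu hrad he

/-- Change variables by x ↦ exp t • x, which preserves the integral, and apply e^s ≥ 1 + s
pointwise. This avoids differentiating u and any boundary term at infinity. -/
theorem mul_integral_exp_le (t : ℝ) :
    t * ∫ x, Real.exp (Module.finrank ℝ E * u x) ≤
      c * ∫ z, kernelIncr J t z * (Real.exp (Module.finrank ℝ E * u z.1) * q z.2)
        ∂(volume.prod volume) := by
  set n : ℝ := (Module.finrank ℝ E : ℝ) with hn
  have hnpos : 0 < n := by rw [hn]; exact_mod_cast Module.finrank_pos
  have hprod := integrable_kernelIncr_mul hJ (he.mul_prod hqi) t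
  rw [integral_prod _ hprod]
  have hinner := hprod.integral_prod_left
  have heq : ∀ x, ∫ y, kernelIncr J t (x, y) * (Real.exp (n * u x) * q y) =
      Real.exp (n * u x) * ∫ y, kernelIncr J t (x, y) * q y := by
    intro x
    rw [← integral_const_mul]
    congr 1; ext y; ring
  simp only [heq] at hinner ⊢
  have hscale : ∫ x, Real.exp (n * t) * Real.exp (n * u (Real.exp t • x)) =
      ∫ x, Real.exp (n * u x) := by
    rw [integral_const_mul,
      Measure.integral_comp_smul volume (fun x => Real.exp (n * u x)) (Real.exp t),
      abs_of_nonneg (by positivity), smul_eq_mul, ← Real.exp_nat_mul, ← mul_assoc, ← hn,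
      mul_inv_cancel₀ (Real.exp_pos _).ne', one_mul]
  have hscale_int : Integrable fun x => Real.exp (n * t) * Real.exp (n * u (Real.exp t • x)) :=
    (he.comp_smul (Real.exp_pos t).ne').const_mul _
  have hlin : Integrable fun x => n * (t * Real.exp (n * u x) -
      c * (Real.exp (n * u x) * ∫ y, kernelIncr J t (x, y) * q y)) :=
    ((he.const_mul t).sub (hinner.const_mul c)).const_mul n
  have hmono : ∫ x, n * (t * Real.exp (n * u x) -
      c * (Real.exp (n * u x) * ∫ y, kernelIncr J t (x, y) * q y)) ≤
      ∫ x, (Real.exp (n * t) * Real.exp (n * u (Real.exp t • x)) - Real.exp (n * u x)) := by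
    refine integral_mono hlin (hscale_int.sub he) fun x => ?_
    have h := potential_exp_smul_sub hJ hq hqi hu hrad t x
    have h1 : Real.exp (n * t) * Real.exp (n * u (Real.exp t • x)) =
        Real.exp (n * u x) * Real.exp (n * (t - c * ∫ y, kernelIncr J t (x, y) * q y)) := by
      rw [← Real.exp_add, ← Real.exp_add]
      congr 1
      linear_combination n * h
    have h2 := Real.add_one_le_exp (n * (t - c * ∫ y, kernelIncr J t (x, y) * q y))
    simp only
    rw [h1]
    nlinarith [mul_le_mul_of_nonneg_left h2 (Real.exp_pos (n * u x)).le]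
  rw [integral_sub hscale_int he, hscale, sub_self, integral_const_mul,
    integral_sub (he.const_mul t) (hinner.const_mul c), integral_const_mul,
    integral_const_mul] at hmono
  have := nonpos_of_mul_nonpos_right hmono hnpos
  linarith

/-- The Pohozaev identity. -/
theorem integral_exp_eq_integral_kernelDeriv :
    ∫ x, Real.exp (Module.finrank ℝ E * u x) =
      c * ∫ z, kernelDeriv J z.1 z.2 * (Real.exp (Module.finrank ℝ E * u z.1) * q z.2)
        ∂(volume.prod volume) := by
  set V := ∫ x, Real.exp (Module.finrank ℝ E * u x) with hV
  have hd := (hasDerivAt_integral_kernelIncr_mul hJ (he.mul_prod hqi)).2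
  have hg := (hd.const_mul c).sub ((hasDerivAt_id (0 : ℝ)).mul_const V)
  -- The inequality holds for t of either sign and is an equality at t = 0, so the derivative of the
  -- difference vanishes there.
  have hmin : IsLocalMin ((fun t => c * ∫ z, kernelIncr J t z *
      (Real.exp (Module.finrank ℝ E * u z.1) * q z.2) ∂(volume.prod volume)) -
        fun t => id t * V) 0 := by
    refine Filter.Eventually.of_forall fun t => ?_
    have h := mul_integral_exp_le hJ hq hqi hu hrad he t
    simpa [kernelIncr] using h
  have := hmin.hasDerivAt_eq_zero hg
  linarith

end Identity

end Pohozaev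

theorem sphereVolume_pos (n : ℕ) : 0 < sphereVolume n := by
  unfold sphereVolume
  rw [Measure.real, ENNReal.toReal_pos_iff]
  refine ⟨?_, measure_lt_top _ _⟩
  rw [Measure.measure_univ_pos]
  exact Measure.toSphere_ne_zero _

/-! ### Volume comparison and the equality case. -/

section VolumeComparison

variable {E : Type*} [NormedAddCommGroup E] [InnerProductSpace ℝ E] [FiniteDimensional ℝ E]
  [MeasurableSpace E] [BorelSpace E] [Nontrivial E]

/-- A nonnegative excess density which is invisible to the kernel vanishes. -/
theorem eq_zero_of_integral_kernelDeriv_mul_eq_zero {J : E →L[ℝ] E}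
    (hJ : IsOrthogonalComplexStructure J) {e p : E → ℝ} (he0 : ∀ x, 0 < e x)
    (he : Integrable e) (hp : Continuous p) (hp0 : ∀ x, 0 ≤ p x) (hpi : Integrable p)
    (h : ∫ z, kernelDeriv J z.1 z.2 * (e z.1 * p z.2) ∂(volume.prod volume) = 0) (y : E) :
    p y = 0 := by
  have hint := (hasDerivAt_integral_kernelIncr_mul hJ (he.mul_prod hpi)).1
  rw [integral_eq_zero_iff_of_nonneg
    (fun z => mul_nonneg (hJ.kernelDeriv_nonneg _ _) (mul_nonneg (he0 _).le (hp0 _))) hint] at h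
  by_contra hy
  set W : Set (E × E) := {z | ‖z.2‖ < ‖z.1‖ ∧ p z.2 ≠ 0} with hW
  -- On W the integrand is nonzero; if p y ≠ 0, W is open and nonempty, hence not null.
  have hWo : IsOpen W := (isOpen_lt continuous_snd.norm continuous_fst.norm).inter
    (isOpen_ne_fun (hp.comp continuous_snd) continuous_const)
  obtain ⟨x, hx⟩ := NormedSpace.exists_lt_norm ℝ E ‖y‖
  have hpos : 0 < (volume.prod volume) W := hWo.measure_pos _ ⟨(x, y), hx, hy⟩
  refine hpos.ne' (measure_mono_null ?_ (ae_iff.1 h))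
  intro z hz
  exact mul_ne_zero (kernelDeriv_pos J hz.1).ne' (mul_ne_zero (he0 _).ne' hz.2)

/-- Volume comparison for radial logarithmic potentials on a space with a complex structure. -/
theorem integral_exp_le_of_log_potential {J : E →L[ℝ] E}
    (hJ : IsOrthogonalComplexStructure J) {Q u : E → ℝ} {N S C₀ : ℝ} (hN : 0 < N) (hS : 0 < S)
    (hQ : Continuous Q) (huc : Continuous u)
    (hqi : Integrable fun x => Q x * Real.exp (Module.finrank ℝ E * u x))
    (hu : ∀ x, u x = 2 / (N * S) * (∫ y, (Real.log ‖y‖ - Real.log ‖x - y‖) *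
      (Q y * Real.exp (Module.finrank ℝ E * u y))) + C₀)
    (hrad : ∀ x y, ‖x‖ = ‖y‖ → u x = u y) (hNQ : ∀ x, N ≤ Q x) :
    Integrable (fun x => Real.exp (Module.finrank ℝ E * u x)) ∧
      ∫ x, Real.exp (Module.finrank ℝ E * u x) ≤ S ∧
      (∫ x, Real.exp (Module.finrank ℝ E * u x) = S ↔ ∀ x, Q x = N) := by
  set e : E → ℝ := fun x => Real.exp (Module.finrank ℝ E * u x) with he_def
  have hec : Continuous e := by fun_prop
  have he0 : ∀ x, 0 < e x := fun x => Real.exp_pos _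
  have he : Integrable e := by
    refine (hqi.const_mul N⁻¹).mono' hec.aestronglyMeasurable (.of_forall fun x => ?_)
    rw [Real.norm_eq_abs, abs_of_pos (he0 x), ← div_eq_inv_mul, le_div_iff₀ hN, mul_comm]
    exact mul_le_mul_of_nonneg_right (hNQ x) (he0 x).le
  refine ⟨he, ?_⟩
  have hid := integral_exp_eq_integral_kernelDeriv hJ (hQ.mul hec) hqi hu hrad he
  have hself := integral_kernelDeriv_mul_self hJ he
  set p : E → ℝ := fun x => (Q x - N) * e x with hp_def
  have hpc : Continuous p := by fun_prop
  have hp0 : ∀ x, 0 ≤ p x := fun x => mul_nonneg (sub_nonneg.2 (hNQ x)) (he0 x).le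
  have hpi : Integrable p := by
    refine (hqi.sub (he.const_mul N)).congr (.of_forall fun x => ?_)
    simp only [hp_def, Pi.sub_apply, he_def]
    ring
  have hKp := (hasDerivAt_integral_kernelIncr_mul hJ (he.mul_prod hpi)).1
  have hKe := (hasDerivAt_integral_kernelIncr_mul hJ (he.mul_prod he)).1
  have hsplit : ∫ z, kernelDeriv J z.1 z.2 * (e z.1 * (Q z.2 * e z.2)) ∂(volume.prod volume) =
      N * ∫ z, kernelDeriv J z.1 z.2 * (e z.1 * e z.2) ∂(volume.prod volume) +
      ∫ z, kernelDeriv J z.1 z.2 * (e z.1 * p z.2) ∂(volume.prod volume) := by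
    rw [← integral_const_mul, ← integral_add (hKe.const_mul N) hKp]
    congr 1; ext z; simp only [hp_def]; ring
  set V := ∫ x, e x with hV
  set P := ∫ z, kernelDeriv J z.1 z.2 * (e z.1 * p z.2) ∂(volume.prod volume) with hP
  have hVpos : 0 < V := integral_pos_of_integrable_nonneg_nonzero (x := 0) hec he
    (fun x => (he0 x).le) (he0 0).ne'
  have hP0 : 0 ≤ P := integral_nonneg fun z =>
    mul_nonneg (hJ.kernelDeriv_nonneg _ _) (mul_nonneg (he0 _).le (hp0 _))
  -- The Pohozaev identity with the constant part of Q symmetrized.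
  have hmain : V * (S - V) = 2 / N * P := by
    have : V = 2 / (N * S) * (N * (V ^ 2 / 2) + P) := by
      rw [← hself, ← hsplit]; exact hid
    field_simp at this ⊢
    linear_combination this
  have hle : V ≤ S := by
    have h1 : 0 ≤ V * (S - V) := hmain ▸ mul_nonneg (by positivity) hP0
    exact sub_nonneg.1 (nonneg_of_mul_nonneg_right h1 hVpos)
  refine ⟨hle, fun hVS => ?_, fun hQN => ?_⟩
  · have hP' : P = 0 := by
      rw [hVS, sub_self, mul_zero] at hmain
      exact (mul_eq_zero.1 hmain.symm).resolve_left (by positivity)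
    intro y
    have := eq_zero_of_integral_kernelDeriv_mul_eq_zero hJ he0 he hpc hp0 hpi hP' y
    exact sub_eq_zero.1 ((mul_eq_zero.1 this).resolve_right (he0 y).ne')
  · have hP' : P = 0 := by simp [hP, hp_def, hQN]
    rw [hP', mul_zero] at hmain
    linarith [(mul_eq_zero.1 hmain).resolve_left hVpos.ne']

end VolumeComparison

theorem theorem1p4 (n : ℕ) (hn : 2 ≤ n) (hn_even : Even n)
    (Q u : EuclideanSpace ℝ (Fin n) → ℝ)
    (hu : IsNormalSolution n Q u) (hrad : IsRadial u)
    (hQ_lower : ∀ x, ((n - 1).factorial : ℝ) ≤ Q x)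
    (hQ_upper : ∃ C k : ℝ, 0 ≤ k ∧ ∀ x, Q x ≤ C * (‖x‖ + 1) ^ k) :
    Integrable (fun x => Real.exp (n * u x)) ∧
      (∫ x, Real.exp (n * u x)) ≤ sphereVolume n ∧
      ((∫ x, Real.exp (n * u x)) = sphereVolume n ↔ ∀ x, Q x = ((n - 1).factorial : ℝ)) := by
  have hfin : Module.finrank ℝ (EuclideanSpace ℝ (Fin n)) = n := finrank_euclideanSpace_fin
  have : Nontrivial (EuclideanSpace ℝ (Fin n)) :=
    Module.nontrivial_of_finrank_pos (R := ℝ) (by omega)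
  obtain ⟨C₀, hC⟩ := hu.integral_equation
  have h := integral_exp_le_of_log_potential (isOrthogonalComplexStructure_std hn_even)
    (Q := Q) (u := u) (C₀ := C₀) (Nat.cast_pos.2 (n - 1).factorial_pos) (sphereVolume_pos n)
    hu.smooth_Q.continuous hu.smooth_u.continuous (by rw [hfin]; exact hu.integrable) ?_ hrad
    hQ_lower
  · rwa [hfin] at h
  intro x
  rw [hfin]
  refine (hC x).trans ?_
  congr 2
  refine integral_congr_ae ?_
  -- The logarithm of the quotient splits only for y ≠ 0 and y ≠ x, hence almost everywhere.
  have h0 : ∀ z : EuclideanSpace ℝ (Fin n), ∀ᵐ y ∂volume, y ≠ z := fun z => by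
    simp [ae_iff, measure_singleton]
  filter_upwards [h0 0, h0 x] with y hy hyx
  rw [Real.log_div (norm_ne_zero_iff.2 hy) (norm_ne_zero_iff.2 (sub_ne_zero.2 hyx.symm))]
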